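/- Let $y_1<y_2$ be real numbers, let $\tau\in(0,\infty)$, and let $X_1,X_2,\dots$ be independent random variables, each uniformly distributed on $(y_1,y_2)$. For $x\in(y_1,y_2)$ and $c\in(0,1)$ put $M_c=y_1+c(y_2-y_1)$ and define the central similarity proximity region $$N(x,\tau,c)=\begin{cases}\left(x-\tau(x-y_1),\;x+\frac{\tau(1-c)(x-y_1)}{c}\right)\cap(y_1,y_2)&\text{if }x\le M_c,\\[1mm] \left(x-\frac{c\,\tau(y_2-x)}{1-c},\;x+\tau(y_2-x)\right)\cap(y_1,y_2)&\text{if }x> M_c.\end{cases}$$ Consider the random digraph with vertices $X_1,\dots,X_n$ and an arc from $X_i$ to $X_j$ ($i\ne j$) if and only if $X_j\in N(X_i,\tau,c)$, and let $\rho_{n,2}(\tau,c)$ be its relative density, that is, its number of arcs divided by $n(n-1)$ (and $0$ if $n\le 1$). Let $\mu(\tau,c)=P(X_2\in N(X_1,\tau,c))$ be the arc probability, let $h_{ij}=\tfrac12\left(\mathbf 1\{X_j\in N(X_i,\tau,c)\}+\mathbf 1\{X_i\in N(X_j,\tau,c)\}\right)$, and let $\nu(\tau,c)=\operatorname{Cov}[h_{12},h_{13}]$.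 Then, for $c=1/2$, as $n\to\infty$, $$\sqrt n\,\bigl[\rho_{n,2}(\tau,1/2)-\mu(\tau,1/2)\bigr]\xrightarrow{\ \mathcal L\ }\mathcal N\bigl(0,4\,\nu(\tau,1/2)\bigr),$$ where $\mathcal N(0,\sigma^2)$ is the normal distribution with mean $0$ and variance $\sigma^2$, $$\mu(\tau,1/2)=\begin{cases}\tau/2&\text{if }0<\tau<1,\\ \tau/(\tau+1)&\text{if }\tau\ge1,\end{cases}\qquad 4\,\nu(\tau,1/2)=\begin{cases}\dfrac{\tau^2(1+2\tau-\tau^2-\tau^3)}{3(\tau+1)^2}&\text{if }0<\tau<1,\\[3mm] \dfrac{2\tau-1}{3(\tau+1)^2}&\text{if }\tau\ge1.\end{cases}$$ -/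

import Mathlib

open MeasureTheory ProbabilityTheory Filter Topology

noncomputable section

namespace CentralSimilarity

/-- The central similarity proximity region `N(x, τ, c)` in the interval `(y₁, y₂)`, with expansion
parameter `τ` and centrality parameter `c`; the centre is `M_c = y₁ + c (y₂ - y₁)`.
At `x = M_c` the two formulas below define the same set, so it does not matter which is used there.
A point `x` outside the open interval, in particular an end point, gets the region `{x}`. -/
def proximityRegion (y₁ y₂ τ c x : ℝ) : Set ℝ :=
  open Classical in
  if x ∈ Set.Ioo y₁ y₂ then
    if x ≤ y₁ + c * (y₂ - y₁) then
      Set.Ioo (x - τ * (x - y₁)) (x + τ * (1 - c) * (x - y₁) / c) ∩ Set.Ioo y₁ y₂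
    else
      Set.Ioo (x - c * τ * (y₂ - x) / (1 - c)) (x + τ * (y₂ - x)) ∩ Set.Ioo y₁ y₂
  else {x}

/-- The proximity catch digraph of the points `X i` for the proximity map `N`:
there is an arc from `i` to `j ≠ i` iff `X j ∈ N (X i)`. -/
def catchDigraph {V : Type*} (N : ℝ → Set ℝ) (X : V → ℝ) : Digraph V where
  Adj i j := i ≠ j ∧ X j ∈ N (X i)

/-- The relative density of a digraph of order `n`: the number of arcs divided by `n (n - 1)`
(it is `0` for `n ≤ 1`, by `a / 0 = 0`). -/
def relativeDensity {V : Type*} [Fintype V] (D : Digraph V) : ℝ :=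
  ({p : V × V | D.Adj p.1 p.2}.ncard : ℝ) / ((Fintype.card V : ℝ) * ((Fintype.card V : ℝ) - 1))

/-- `ρ_{n,2}(τ, c)` for the sample `x₀, …, x_{n-1}` of points of `(y₁, y₂)`. -/
def rho (y₁ y₂ τ c : ℝ) (n : ℕ) (x : Fin n → ℝ) : ℝ :=
  relativeDensity (catchDigraph (proximityRegion y₁ y₂ τ c) x)

/-- The uniform distribution on `(y₁, y₂)`. -/
def uniformLaw (y₁ y₂ : ℝ) : Measure ℝ := ProbabilityTheory.cond volume (Set.Ioo y₁ y₂)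

/-- The arc probability `μ(τ, c) = P(X₂ ∈ N(X₁, τ, c))`, with `X₁, X₂` iid uniform on
`(y₁, y₂)`. -/
def mu (y₁ y₂ τ c : ℝ) : ℝ :=
  ((uniformLaw y₁ y₂).prod (uniformLaw y₁ y₂)).real
    {p | p.2 ∈ proximityRegion y₁ y₂ τ c p.1}

/-- The symmetric kernel `h(u, v) = (I(v ∈ N(u, τ, c)) + I(u ∈ N(v, τ, c))) / 2`. -/
def kernelH (y₁ y₂ τ c u v : ℝ) : ℝ :=
  ((proximityRegion y₁ y₂ τ c u).indicator 1 v + (proximityRegion y₁ y₂ τ c v).indicator 1 u) / 2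

/-- `ν(τ, c) = Cov[h(X₁, X₂), h(X₁, X₃)]`, with `X₁, X₂, X₃` iid uniform on `(y₁, y₂)`. -/
def nu (y₁ y₂ τ c : ℝ) : ℝ :=
  covariance (fun p : ℝ × ℝ × ℝ => kernelH y₁ y₂ τ c p.1 p.2.1)
    (fun p : ℝ × ℝ × ℝ => kernelH y₁ y₂ τ c p.1 p.2.2)
    ((uniformLaw y₁ y₂).prod ((uniformLaw y₁ y₂).prod (uniformLaw y₁ y₂)))

end CentralSimilarity

end

/-! Averaging the two arc directions turns the relative density into a U-statistic of degree two
with the bounded symmetric kernel `kernelH`, so Hoeffding's theorem applies for every `c`; only the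
closed forms need `c = 1/2`.

Hoeffding's theorem: with `h₁ x = ∫ h x y` and `θ = ∫ h₁`, the remainder `g x y = h x y - h₁ x - h₁
y + θ` is degenerate (it integrates to zero in each variable). In the second moment of its sum over
ordered pairs only terms with the same unordered pair survive, so that moment is O(n²)
(`integral_sq_sum_degenerate_le`). After scaling by √n / (n(n - 1)) the remainder vanishes in
probability, and the classical CLT for `2 * h₁ (X i)` with Slutsky's lemma gives variance 4 Var h₁.
Conditioning on the first point shows Var h₁ = ν (`covariance_kernel_eq_variance`).

Moments: `h₁` is half the sum of the out- and in-probabilities of a point. An affine map moves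
everything to (0, 1), where for `c = 1/2` there is an arc t → s iff |s - t| < τ min(t, 1 - t)
(`arcIndicator_affine`). Reflection reduces to t ≤ 1/2; there both probabilities are lengths of
intervals, hence piecewise linear in t, and `mu` and `nu` become integrals of polynomials. -/

namespace CentralSimilarity

/-! ### Hoeffding's central limit theorem for U-statistics. -/

section UStatistic

variable {Ω E F : Type*} [MeasurableSpace Ω] [MeasurableSpace E] [MeasurableSpace F]
  {P : Measure Ω} {m : Measure E}

theorem aemeasurable_kernel_comp {X : ℕ → Ω → E} (hlaw : ∀ i, HasLaw (X i) m P) {g : E → E → ℝ}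
    (hg : Measurable (Function.uncurry g)) (i j : ℕ) :
    AEMeasurable (fun ω => g (X i ω) (X j ω)) P :=
  hg.comp_aemeasurable (f := fun ω => (X i ω, X j ω))
    ((hlaw i).aemeasurable.prodMk (hlaw j).aemeasurable)

variable [IsProbabilityMeasure P] [IsProbabilityMeasure m]

theorem integrable_of_measurable_of_bound {f : E → ℝ} (hf : Measurable f) {C : ℝ}
    (hC : ∀ x, |f x| ≤ C) : Integrable f m :=
  Integrable.of_bound hf.aestronglyMeasurable C (ae_of_all _ hC)

theorem abs_integral_le_of_bound {f : E → ℝ} {C : ℝ} (hC : ∀ x, |f x| ≤ C) :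
    |∫ x, f x ∂m| ≤ C := by
  simpa using norm_integral_le_of_norm_le_const (μ := m) (f := f) (ae_of_all m hC)

/-- By independence the joint law is a product, so Fubini allows integrating over `Y` first. -/
theorem IndepFun.integral_eq_zero_of_forall_integral_eq_zero {Z : Ω → F} {Y : Ω → E}
    (hZ : AEMeasurable Z P) (hY : HasLaw Y m P) (hZY : IndepFun Z Y P)
    {G : F → E → ℝ} (hG : Measurable (Function.uncurry G)) {C : ℝ} (hC : ∀ z y, |G z y| ≤ C)
    (h0 : ∀ z, ∫ y, G z y ∂m = 0) :
    ∫ ω, G (Z ω) (Y ω) ∂P = 0 := by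
  have hmap := (indepFun_iff_map_prod_eq_prod_map_map hZ hY.aemeasurable).1 hZY
  have : IsProbabilityMeasure (P.map Z) := Measure.isProbabilityMeasure_map hZ
  calc ∫ ω, G (Z ω) (Y ω) ∂P
      = ∫ p, Function.uncurry G p ∂(P.map fun ω => (Z ω, Y ω)) :=
        (integral_map (hZ.prodMk hY.aemeasurable) hG.aestronglyMeasurable).symm
    _ = ∫ z, ∫ y, G z y ∂m ∂(P.map Z) := by
        rw [hmap, hY.map_eq, integral_prod]
        · rfl
        · exact integrable_of_measurable_of_bound hG fun p => hC p.1 p.2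
    _ = 0 := by simp [h0]

variable {X : ℕ → Ω → E}

/-- The index `j` occurs only once in the product, so integrating over `X j` with the other
variables held fixed already gives zero. Collecting the others in a `Finset` allows `i`, `k`, `l` to
coincide. -/
theorem integral_degenerate_mul_eq_zero (hlaw : ∀ i, HasLaw (X i) m P) (hindep : iIndepFun X P)
    {g : E → E → ℝ} (hg : Measurable (Function.uncurry g)) {C : ℝ} (hC : ∀ x y, |g x y| ≤ C)
    (h0 : ∀ x, ∫ y, g x y ∂m = 0) {i j k l : ℕ} (hij : i ≠ j) (hkj : k ≠ j) (hlj : l ≠ j) :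
    ∫ ω, g (X i ω) (X j ω) * g (X k ω) (X l ω) ∂P = 0 := by
  classical
  let S : Finset ℕ := {i, k, l}
  let T : Finset ℕ := {j}
  have hST : Disjoint S T := by simp [S, T, hij.symm, hkj.symm, hlj.symm]
  have hXm : ∀ i, AEMeasurable (X i) P := fun i => (hlaw i).aemeasurable
  have hI := hindep.indepFun_finset₀ S T hST hXm
  have hI' : IndepFun (fun ω (a : S) => X a ω) (X j) P :=
    hI.comp measurable_id (measurable_pi_apply (⟨j, by simp [T]⟩ : T))
  have hC0 : 0 ≤ C := by
    obtain ⟨x⟩ := nonempty_of_isProbabilityMeasure m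
    exact (abs_nonneg _).trans (hC x x)
  refine IndepFun.integral_eq_zero_of_forall_integral_eq_zero
    (Z := fun ω (a : S) => X a ω) (Y := X j) (aemeasurable_pi_lambda _ fun a => hXm a)
    (hlaw j) hI' (C := C * C)
    (G := fun z y => g (z ⟨i, by simp [S]⟩) y * g (z ⟨k, by simp [S]⟩) (z ⟨l, by simp [S]⟩))
    ?_ ?_ ?_
  · refine Measurable.mul ?_ ?_
    · exact hg.comp (f := fun p : (S → E) × E => (p.1 ⟨i, by simp [S]⟩, p.2)) (by fun_prop)
    · exact hg.comp (f := fun p : (S → E) × E => (p.1 ⟨k, by simp [S]⟩, p.1 ⟨l, by simp [S]⟩))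
        (by fun_prop)
  · intro z y
    rw [abs_mul]
    exact mul_le_mul (hC _ _) (hC _ _) (abs_nonneg _) hC0
  · intro z
    simp [integral_mul_const, h0]

/-- Expand the square: a product over pairs p, q has mean zero unless both have the same underlying
set, that is, q is p or its swap. This gives at most two terms for each of the n(n - 1) pairs p. -/
theorem integral_sq_sum_degenerate_le (hlaw : ∀ i, HasLaw (X i) m P) (hindep : iIndepFun X P)
    {g : E → E → ℝ} (hg : Measurable (Function.uncurry g)) (hsymm : ∀ x y, g x y = g y x)
    {C : ℝ} (hC : ∀ x y, |g x y| ≤ C) (h0 : ∀ x, ∫ y, g x y ∂m = 0) (n : ℕ) :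
    ∫ ω, (∑ p ∈ (Finset.range n).offDiag, g (X p.1 ω) (X p.2 ω)) ^ 2 ∂P
      ≤ n * (n - 1) * (2 * C ^ 2) := by
  have hC2 : ∀ x y x' y', |g x y * g x' y'| ≤ C ^ 2 := fun x y x' y' => by
    rw [abs_mul, sq]
    exact mul_le_mul (hC _ _) (hC _ _) (abs_nonneg _) ((abs_nonneg _).trans (hC x y))
  have hint : ∀ p q : ℕ × ℕ,
      Integrable (fun ω => g (X p.1 ω) (X p.2 ω) * g (X q.1 ω) (X q.2 ω)) P := fun p q =>
    Integrable.of_bound ((aemeasurable_kernel_comp hlaw hg _ _).mul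
      (aemeasurable_kernel_comp hlaw hg _ _)).aestronglyMeasurable (C ^ 2)
      (ae_of_all _ fun ω => hC2 _ _ _ _)
  have hpq : ∀ p ∈ (Finset.range n).offDiag, ∀ q ∈ (Finset.range n).offDiag,
      ∫ ω, g (X p.1 ω) (X p.2 ω) * g (X q.1 ω) (X q.2 ω) ∂P
        ≤ (if q = p then C ^ 2 else 0) + (if q = p.swap then C ^ 2 else 0) := by
    rintro ⟨i, j⟩ hp ⟨k, l⟩ hq
    simp only [Finset.mem_offDiag] at hp hq
    have hle : ∫ ω, g (X i ω) (X j ω) * g (X k ω) (X l ω) ∂P ≤ C ^ 2 :=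
      (le_abs_self _).trans (abs_integral_le_of_bound fun ω => hC2 _ _ _ _)
    have hCC := sq_nonneg C
    by_cases h1 : k = j ∨ l = j
    · by_cases h2 : k = i ∨ l = i
      · have : (k, l) = (i, j) ∨ (k, l) = (i, j).swap := by
          simp only [Prod.swap_prod_mk, Prod.mk.injEq]
          lia
        rcases this with h | h <;> rw [if_pos h] <;> split_ifs <;> linarith
      -- Here `i` is the index that occurs once; symmetry of `g` moves it to the second argument.
      · push Not at h2
        have := integral_degenerate_mul_eq_zero hlaw hindep hg hC h0 hp.2.2.symm h2.1 h2.2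
        simp only [hsymm (X j _)] at this
        simp only [this]
        positivity
    · push Not at h1
      rw [integral_degenerate_mul_eq_zero hlaw hindep hg hC h0 hp.2.2 h1.1 h1.2]
      positivity
  simp_rw [sq (Finset.sum _ _), Finset.sum_mul_sum]
  rw [integral_finsetSum _ fun p _ => integrable_finsetSum _ fun q _ => hint p q]
  simp_rw [integral_finsetSum _ fun q _ => hint _ q]
  calc _ ≤ ∑ p ∈ (Finset.range n).offDiag, (2 * C ^ 2) := by
        refine Finset.sum_le_sum fun p hp => ?_
        refine (Finset.sum_le_sum fun q hq => hpq p hp q hq).trans ?_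
        rw [Finset.sum_add_distrib, Finset.sum_ite_eq', Finset.sum_ite_eq', two_mul]
        have := sq_nonneg C
        gcongr <;> split_ifs <;> linarith
    _ = _ := by
        rw [Finset.sum_const, Finset.offDiag_card, nsmul_eq_mul, Finset.card_range,
          Nat.cast_sub (Nat.le_mul_self n)]
        push_cast
        ring

/-- Each index is the first entry of n - 1 off-diagonal pairs and the second entry of as many. -/
theorem sum_offDiag_add (f : ℕ → ℝ) (n : ℕ) :
    ∑ p ∈ (Finset.range n).offDiag, (f p.1 + f p.2)
      = 2 * ((n : ℝ) - 1) * ∑ i ∈ Finset.range n, f i := by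
  have h : ∑ p ∈ (Finset.range n).offDiag, (f p.1 + f p.2)
      + ∑ p ∈ (Finset.range n).diag, (f p.1 + f p.2)
      = ∑ p ∈ Finset.range n ×ˢ Finset.range n, (f p.1 + f p.2) := by
    rw [← Finset.sum_union (Finset.disjoint_diag_offDiag _).symm, Finset.union_comm,
      Finset.diag_union_offDiag]
  rw [Finset.sum_diag, Finset.sum_product] at h
  simp only [Finset.sum_add_distrib, Finset.sum_const, Finset.card_range, nsmul_eq_mul,
    ← Finset.mul_sum] at h
  simp only [Finset.sum_add_distrib]
  linear_combination h

/-- **Hoeffding's central limit theorem** for U-statistics with a bounded symmetric kernel of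
degree two. -/
theorem tendstoInDistribution_uStatistic (hlaw : ∀ i, HasLaw (X i) m P) (hindep : iIndepFun X P)
    {h : E → E → ℝ} (hh : Measurable (Function.uncurry h)) (hsymm : ∀ x y, h x y = h y x)
    {C : ℝ} (hC : ∀ x y, |h x y| ≤ C) :
    TendstoInDistribution
      (fun (n : ℕ) ω => √(n : ℝ) *
        ((∑ p ∈ (Finset.range n).offDiag, h (X p.1 ω) (X p.2 ω)) / ((n : ℝ) * ((n : ℝ) - 1))
          - ∫ x, ∫ y, h x y ∂m ∂m))
      atTop (id : ℝ → ℝ) (fun _ => P)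
      (gaussianReal 0 (4 * Var[fun x => ∫ y, h x y ∂m; m]).toNNReal) := by
  set h₁ : E → ℝ := fun x => ∫ y, h x y ∂m with hh₁
  set θ : ℝ := ∫ x, h₁ x ∂m with hθ
  have hm₁ : Measurable h₁ := hh.stronglyMeasurable.integral_prod_right.measurable
  have hC₁ : ∀ x, |h₁ x| ≤ C := fun x => abs_integral_le_of_bound (hC x)
  have hCθ : |θ| ≤ C := abs_integral_le_of_bound hC₁
  -- The completely degenerate part in the Hoeffding decomposition of `h`.
  set g : E → E → ℝ := fun x y => h x y - (h₁ x + h₁ y) + θ with hg_def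
  have hg : Measurable (Function.uncurry g) :=
    (hh.sub ((hm₁.comp measurable_fst).add (hm₁.comp measurable_snd))).add_const θ
  have hgC : ∀ x y, |g x y| ≤ 4 * C := fun x y => by
    have h1 := abs_le.1 (hC x y)
    have h2 := abs_le.1 (hC₁ x)
    have h3 := abs_le.1 (hC₁ y)
    have h4 := abs_le.1 hCθ
    exact abs_le.2 ⟨by simp only [hg_def]; linarith, by simp only [hg_def]; linarith⟩
  have hg0 : ∀ x, ∫ y, g x y ∂m = 0 := fun x => by
    have i1 : Integrable (h x) m := integrable_of_measurable_of_bound hh.of_uncurry_left (hC x)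
    have i2 : Integrable h₁ m := integrable_of_measurable_of_bound hm₁ hC₁
    simp only [hg_def]
    have i3 : Integrable (fun y => h₁ x + h₁ y) m := (integrable_const _).add i2
    have i4 : Integrable (fun y => h x y - (h₁ x + h₁ y)) m := i1.sub i3
    rw [integral_add i4 (integrable_const _), integral_sub i1 i3,
      integral_add (integrable_const _) i2]
    simp only [integral_const, probReal_univ, one_smul, ← hθ]
    change h₁ x - (h₁ x + θ) + θ = 0
    ring
  have hgs : ∀ x y, g x y = g y x := fun x y => by simp only [hg_def, hsymm x y]; ring
  have hident : ∀ i, IdentDistrib (fun ω => 2 * h₁ (X i ω)) (fun ω => 2 * h₁ (X 0 ω)) P P :=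
    fun i => ((hlaw i).identDistrib (hlaw 0)).comp (hm₁.const_mul 2)
  have hmean : P[fun ω => 2 * h₁ (X 0 ω)] = 2 * θ := by
    rw [integral_const_mul, hθ, ← (hlaw 0).integral_comp hm₁.aestronglyMeasurable]
    rfl
  have hvar : Var[fun ω => 2 * h₁ (X 0 ω); P] = 4 * Var[h₁; m] := by
    rw [variance_const_mul, ← (hlaw 0).map_eq,
      variance_map hm₁.aemeasurable (hlaw 0).aemeasurable]
    norm_num [Function.comp_def]
  have clt := tendstoInDistribution_inv_sqrt_mul_sum_sub (P := P)
    (X := fun i ω => 2 * h₁ (X i ω)) (Y := (id : ℝ → ℝ))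
    (P' := gaussianReal 0 (4 * Var[h₁; m]).toNNReal)
    ⟨aemeasurable_id, by rw [hvar, Measure.map_id]⟩
    (MemLp.of_bound ((hm₁.comp_aemeasurable (hlaw 0).aemeasurable).const_mul 2).aestronglyMeasurable
      (2 * C) (ae_of_all _ fun ω => by
        rw [Real.norm_eq_abs, abs_mul, abs_two]
        exact mul_le_mul_of_nonneg_left (hC₁ _) zero_le_two))
    (hindep.comp (fun _ x => 2 * h₁ x) fun _ => hm₁.const_mul 2) hident
  simp only [hmean] at clt
  -- Slutsky: it remains to show that the U-statistic and its projection differ by a null sequence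
  -- in probability.
  refine tendstoInDistribution_of_tendstoInMeasure_sub _ _ clt ?_ fun n => ?_
  · set R : ℕ → Ω → ℝ := fun n ω =>
      ∑ p ∈ (Finset.range n).offDiag, g (X p.1 ω) (X p.2 ω) with hR
    have hRm : ∀ n, AEMeasurable (R n) P := fun n =>
      Finset.aemeasurable_fun_sum _ fun p _ => aemeasurable_kernel_comp hlaw hg _ _
    have hRint : ∀ n, Integrable (fun ω => R n ω ^ 2) P := fun n => by
      refine Integrable.of_bound ((hRm n).pow_const 2).aestronglyMeasurable
        ((∑ p ∈ (Finset.range n).offDiag, 4 * C) ^ 2) (ae_of_all _ fun ω => ?_)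
      rw [Real.norm_eq_abs, abs_pow]
      exact pow_le_pow_left₀ (abs_nonneg _) ((Finset.abs_sum_le_sum_abs _ _).trans
        (Finset.sum_le_sum fun p _ => hgC _ _)) 2
    have hR2 := integral_sq_sum_degenerate_le hlaw hindep hg hgs hgC hg0
    have hdiff : ∀ n : ℕ, 2 ≤ n → ∀ ω, √(n : ℝ) *
        ((∑ p ∈ (Finset.range n).offDiag, h (X p.1 ω) (X p.2 ω)) / ((n : ℝ) * ((n : ℝ) - 1)) - θ)
        - (√(n : ℝ))⁻¹ * (∑ k ∈ Finset.range n, 2 * h₁ (X k ω) - n * (2 * θ))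
        = √(n : ℝ) / ((n : ℝ) * ((n : ℝ) - 1)) * R n ω := by
      intro n hn ω
      have hn' : (2 : ℝ) ≤ n := by exact_mod_cast hn
      have e1 : R n ω = (∑ p ∈ (Finset.range n).offDiag, h (X p.1 ω) (X p.2 ω))
          - 2 * ((n : ℝ) - 1) * ∑ i ∈ Finset.range n, h₁ (X i ω) + n * (n - 1) * θ := by
        simp only [hR, hg_def, Finset.sum_add_distrib (f := fun _ => _ - _),
          Finset.sum_sub_distrib]
        rw [sum_offDiag_add (fun i => h₁ (X i ω)), Finset.sum_const, Finset.offDiag_card,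
          nsmul_eq_mul, Finset.card_range, Nat.cast_sub (Nat.le_mul_self n)]
        push_cast
        ring
      have hs : √(n : ℝ) ≠ 0 := (Real.sqrt_pos.2 (by linarith)).ne'
      have hsq : √(n : ℝ) ^ 2 = n := Real.sq_sqrt (by linarith)
      have h1 : (n : ℝ) - 1 ≠ 0 := by linarith
      rw [e1, ← Finset.mul_sum]
      have hinv : (√(n : ℝ))⁻¹ = √(n : ℝ) / n := by
        rw [← hsq, Real.sqrt_sq (Real.sqrt_nonneg _)]; field_simp
      rw [hinv]
      have h2 : (n : ℝ) ≠ 0 := by linarith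
      field_simp
      ring
    rw [tendstoInMeasure_iff_measureReal_norm]
    intro ε hε
    have hbd : ∀ᶠ n : ℕ in atTop, P.real {ω | ε ≤ ‖(√(n : ℝ) *
        ((∑ p ∈ (Finset.range n).offDiag, h (X p.1 ω) (X p.2 ω)) / ((n : ℝ) * ((n : ℝ) - 1)) - θ)
        - (√(n : ℝ))⁻¹ * (∑ k ∈ Finset.range n, 2 * h₁ (X k ω) - n * (2 * θ))) - 0‖}
          ≤ (2 * (4 * C) ^ 2 / ε ^ 2) / ((n : ℝ) - 1) := by
      filter_upwards [eventually_ge_atTop 2] with n hn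
      have hn' : (2 : ℝ) ≤ n := by exact_mod_cast hn
      simp only [hdiff n hn, sub_zero]
      set c : ℝ := √(n : ℝ) / ((n : ℝ) * ((n : ℝ) - 1)) with hc
      have hsq : c ^ 2 = 1 / ((n : ℝ) * ((n : ℝ) - 1) ^ 2) := by
        rw [hc, div_pow, Real.sq_sqrt (by linarith)]
        have h1 : (n : ℝ) - 1 ≠ 0 := by linarith
        have h2 : (n : ℝ) ≠ 0 := by linarith
        field_simp
      have hset : {ω | ε ≤ ‖c * R n ω‖} = {ω | ε ^ 2 ≤ c ^ 2 * R n ω ^ 2} := by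
        ext ω
        rw [Set.mem_ofPred_eq, Set.mem_ofPred_eq, ← mul_pow, ← sq_abs (c * R n ω),
          Real.norm_eq_abs, pow_le_pow_iff_left₀ hε.le (abs_nonneg _) two_ne_zero]
      -- Markov's inequality for the squared remainder; the factor c² n(n - 1) equals 1/(n - 1).
      have hmk := mul_meas_ge_le_integral_of_nonneg (μ := P)
        (ae_of_all _ fun ω => by positivity : 0 ≤ᵐ[P] fun ω => c ^ 2 * R n ω ^ 2)
        ((hRint n).const_mul _) (ε ^ 2)
      rw [integral_const_mul] at hmk
      have hc2 : 0 ≤ c ^ 2 := sq_nonneg c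
      have := mul_le_mul_of_nonneg_left (hR2 n) hc2
      rw [hset, div_div, le_div_iff₀ (by have := sq_pos_of_pos hε; nlinarith)]
      have h3 : c ^ 2 * (↑n * (↑n - 1) * (2 * (4 * C) ^ 2)) * ((n : ℝ) - 1)
          = 2 * (4 * C) ^ 2 := by
        rw [hsq]
        have h1 : (n : ℝ) - 1 ≠ 0 := by linarith
        have h2 : (n : ℝ) ≠ 0 := by linarith
        field_simp
      rw [← h3]
      calc _ = (ε ^ 2 * P.real {ω | ε ^ 2 ≤ c ^ 2 * R n ω ^ 2}) * ((n : ℝ) - 1) := by ring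
        _ ≤ _ := mul_le_mul_of_nonneg_right (hmk.trans this) (by linarith)
    refine tendsto_of_tendsto_of_tendsto_of_le_of_le' tendsto_const_nhds ?_
      (Eventually.of_forall fun n => measureReal_nonneg) hbd
    exact Tendsto.const_div_atTop
      (tendsto_atTop_add_const_right _ (-1) tendsto_natCast_atTop_atTop) _
  · exact (((Finset.aemeasurable_fun_sum _ fun p _ =>
      aemeasurable_kernel_comp hlaw hh _ _).div_const _).sub_const _).const_mul _

end UStatistic

/-! ### The covariance of two kernel values sharing a point. -/

section Kernel

variable {E : Type*} [MeasurableSpace E] {m : Measure E} [IsProbabilityMeasure m]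

/-- Given the shared point x, the two kernel values are independent with common mean `∫ y, h x y`,
so their product has conditional mean equal to the square of that. -/
theorem covariance_kernel_eq_variance {h : E → E → ℝ} (hh : Measurable (Function.uncurry h))
    {C : ℝ} (hC : ∀ x y, |h x y| ≤ C) :
    cov[fun p : E × E × E => h p.1 p.2.1, fun p : E × E × E => h p.1 p.2.2;
      m.prod (m.prod m)] = Var[fun x => ∫ y, h x y ∂m; m] := by
  have hm₁ : Measurable fun x => ∫ y, h x y ∂m :=
    hh.stronglyMeasurable.integral_prod_right.measurable
  have hf : Measurable fun p : E × E × E => h p.1 p.2.1 :=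
    hh.comp (f := fun p : E × E × E => (p.1, p.2.1)) (by fun_prop)
  have hg : Measurable fun p : E × E × E => h p.1 p.2.2 :=
    hh.comp (f := fun p : E × E × E => (p.1, p.2.2)) (by fun_prop)
  have hf2 : MemLp (fun p : E × E × E => h p.1 p.2.1) 2 (m.prod (m.prod m)) :=
    MemLp.of_bound hf.aestronglyMeasurable C (ae_of_all _ fun p => hC _ _)
  have hg2 : MemLp (fun p : E × E × E => h p.1 p.2.2) 2 (m.prod (m.prod m)) :=
    MemLp.of_bound hg.aestronglyMeasurable C (ae_of_all _ fun p => hC _ _)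
  have h₁2 : MemLp (fun x => ∫ y, h x y ∂m) 2 m :=
    MemLp.of_bound hm₁.aestronglyMeasurable C
      (ae_of_all _ fun x => abs_integral_le_of_bound (hC x))
  rw [covariance_eq_sub hf2 hg2, variance_eq_sub h₁2, sq (∫ x, _ ∂m)]
  have e1 : ∫ p : E × E × E, h p.1 p.2.1 ∂(m.prod (m.prod m)) = ∫ x, ∫ y, h x y ∂m ∂m := by
    rw [integral_prod _ (hf2.integrable one_le_two)]
    refine integral_congr_ae (ae_of_all _ fun x => ?_)
    simpa using integral_fun_fst (μ := m) (ν := m) (h x)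
  have e2 : ∫ p : E × E × E, h p.1 p.2.2 ∂(m.prod (m.prod m)) = ∫ x, ∫ y, h x y ∂m ∂m := by
    rw [integral_prod _ (hg2.integrable one_le_two)]
    refine integral_congr_ae (ae_of_all _ fun x => ?_)
    simpa using integral_fun_snd (μ := m) (ν := m) (h x)
  rw [e1, e2]
  congr 1
  rw [integral_prod _ (hf2.integrable_mul hg2)]
  refine integral_congr_ae (ae_of_all _ fun x => ?_)
  simp only [Pi.mul_apply, Pi.pow_apply, sq]
  exact integral_prod_mul (h x) (h x)

end Kernel

/-! ### The digraph as a U-statistic, for arbitrary centrality. -/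

/-- The indicator `I(v ∈ N(u, τ, c))`. -/
noncomputable def arcIndicator (y₁ y₂ τ c u v : ℝ) : ℝ :=
  (proximityRegion y₁ y₂ τ c u).indicator 1 v

variable (y₁ y₂ τ c : ℝ)

theorem measurableSet_setOf_mem_proximityRegion :
    MeasurableSet {p : ℝ × ℝ | p.2 ∈ proximityRegion y₁ y₂ τ c p.1} := by
  have h : {p : ℝ × ℝ | p.2 ∈ proximityRegion y₁ y₂ τ c p.1} =
      {p | (p.1 ∈ Set.Ioo y₁ y₂ ∧
          (p.1 ≤ y₁ + c * (y₂ - y₁) ∧ (p.1 - τ * (p.1 - y₁) < p.2 ∧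
            p.2 < p.1 + τ * (1 - c) * (p.1 - y₁) / c) ∧ p.2 ∈ Set.Ioo y₁ y₂ ∨
          ¬ p.1 ≤ y₁ + c * (y₂ - y₁) ∧ (p.1 - c * τ * (y₂ - p.1) / (1 - c) < p.2 ∧
            p.2 < p.1 + τ * (y₂ - p.1)) ∧ p.2 ∈ Set.Ioo y₁ y₂)) ∨
        (¬ p.1 ∈ Set.Ioo y₁ y₂ ∧ p.2 = p.1)} := by
    ext p
    simp only [Set.mem_ofPred_eq, proximityRegion]
    split_ifs with h1 h2 <;> simp [*, Set.mem_Ioo]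
  rw [h]
  simp only [Set.mem_Ioo]
  measurability

theorem measurable_arcIndicator : Measurable (Function.uncurry (arcIndicator y₁ y₂ τ c)) :=
  (measurable_const (a := (1 : ℝ))).indicator
    (measurableSet_setOf_mem_proximityRegion y₁ y₂ τ c)

theorem arcIndicator_mem_Icc (u v : ℝ) : arcIndicator y₁ y₂ τ c u v ∈ Set.Icc (0 : ℝ) 1 := by
  unfold arcIndicator
  by_cases h : v ∈ proximityRegion y₁ y₂ τ c u <;> simp [h]

theorem abs_arcIndicator_le (u v : ℝ) : |arcIndicator y₁ y₂ τ c u v| ≤ 1 := by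
  have := arcIndicator_mem_Icc y₁ y₂ τ c u v
  rw [abs_of_nonneg this.1]
  exact this.2

theorem kernelH_eq (u v : ℝ) : kernelH y₁ y₂ τ c u v =
    (arcIndicator y₁ y₂ τ c u v + arcIndicator y₁ y₂ τ c v u) / 2 := rfl

theorem measurable_kernelH : Measurable (Function.uncurry (kernelH y₁ y₂ τ c)) :=
  ((measurable_arcIndicator y₁ y₂ τ c).add
    ((measurable_arcIndicator y₁ y₂ τ c).comp measurable_swap)).div_const 2

theorem abs_kernelH_le (u v : ℝ) : |kernelH y₁ y₂ τ c u v| ≤ 1 := by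
  have h1 := arcIndicator_mem_Icc y₁ y₂ τ c u v
  have h2 := arcIndicator_mem_Icc y₁ y₂ τ c v u
  rw [kernelH_eq, abs_le]
  exact ⟨by linarith [h1.1, h2.1], by linarith [h1.2, h2.2]⟩

theorem kernelH_comm (u v : ℝ) : kernelH y₁ y₂ τ c u v = kernelH y₁ y₂ τ c v u := by
  rw [kernelH_eq, kernelH_eq, add_comm]

/-- Summed over all ordered pairs, the two directions in the kernel contribute equally, so
symmetrizing leaves the arc count unchanged. -/
theorem rho_eq_uStatistic (n : ℕ) (x : ℕ → ℝ) :
    rho y₁ y₂ τ c n (fun i => x i) =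
      (∑ p ∈ (Finset.range n).offDiag, kernelH y₁ y₂ τ c (x p.1) (x p.2))
        / ((n : ℝ) * ((n : ℝ) - 1)) := by
  classical
  have hsum : ∀ f : ℕ → ℕ → ℝ, ∑ p ∈ (Finset.range n).offDiag, f p.1 p.2 =
      ∑ i : Fin n, ∑ j : Fin n, if (i : ℕ) ≠ j then f i j else 0 := fun f => by
    have h : (Finset.range n).offDiag =
        {p ∈ Finset.range n ×ˢ Finset.range n | p.1 ≠ p.2} := by
      ext p
      simp [and_assoc]
    rw [h, Finset.sum_filter, Finset.sum_product, Finset.sum_range]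
    exact Finset.sum_congr rfl fun i _ => Finset.sum_range _
  have hswap : ∑ p ∈ (Finset.range n).offDiag, arcIndicator y₁ y₂ τ c (x p.2) (x p.1) =
      ∑ p ∈ (Finset.range n).offDiag, arcIndicator y₁ y₂ τ c (x p.1) (x p.2) := by
    rw [hsum fun i j => arcIndicator y₁ y₂ τ c (x j) (x i),
      hsum fun i j => arcIndicator y₁ y₂ τ c (x i) (x j), Finset.sum_comm]
    simp only [ne_comm]
  have hker : ∑ p ∈ (Finset.range n).offDiag, kernelH y₁ y₂ τ c (x p.1) (x p.2) =
      ∑ p ∈ (Finset.range n).offDiag, arcIndicator y₁ y₂ τ c (x p.1) (x p.2) := by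
    simp only [kernelH_eq]
    rw [← Finset.sum_div, Finset.sum_add_distrib, hswap]
    ring
  rw [hker, hsum fun i j => arcIndicator y₁ y₂ τ c (x i) (x j), rho, relativeDensity,
    Fintype.card_fin]
  congr 1
  rw [Set.ncard_eq_toFinset_card', Finset.card_eq_sum_ones, Set.toFinset_ofPred, Finset.sum_filter,
    ← Finset.univ_product_univ, Finset.sum_product]
  push_cast
  refine Finset.sum_congr rfl fun i _ => Finset.sum_congr rfl fun j _ => ?_
  have hadj : (catchDigraph (proximityRegion y₁ y₂ τ c) fun i : Fin n => x i).Adj i j ↔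
      (i : ℕ) ≠ j ∧ x j ∈ proximityRegion y₁ y₂ τ c (x i) :=
    and_congr_left' Fin.val_ne_iff.symm
  refine (if_congr hadj rfl rfl).trans ?_
  rw [ite_and, arcIndicator, Set.indicator_apply, Pi.one_apply]

theorem isProbabilityMeasure_uniformLaw {y₁ y₂ : ℝ} (hy : y₁ < y₂) :
    IsProbabilityMeasure (uniformLaw y₁ y₂) :=
  cond_isProbabilityMeasure_of_finite (by simpa using hy) (by simp)

variable {y₁ y₂}

theorem integral_integral_arcIndicator (hy : y₁ < y₂) :
    ∫ u, ∫ v, arcIndicator y₁ y₂ τ c u v ∂uniformLaw y₁ y₂ ∂uniformLaw y₁ y₂ =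
      mu y₁ y₂ τ c := by
  have := isProbabilityMeasure_uniformLaw hy
  rw [mu, ← integral_indicator_one (measurableSet_setOf_mem_proximityRegion y₁ y₂ τ c)]
  exact (integral_prod _ (integrable_of_measurable_of_bound
    (measurable_arcIndicator y₁ y₂ τ c) fun p => abs_arcIndicator_le y₁ y₂ τ c p.1 p.2)).symm

theorem integral_integral_arcIndicator_swap (hy : y₁ < y₂) :
    ∫ u, ∫ v, arcIndicator y₁ y₂ τ c v u ∂uniformLaw y₁ y₂ ∂uniformLaw y₁ y₂ =
      mu y₁ y₂ τ c := by
  have := isProbabilityMeasure_uniformLaw hy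
  rw [← integral_integral_arcIndicator τ c hy]
  exact (integral_integral_swap (integrable_of_measurable_of_bound
    (measurable_arcIndicator y₁ y₂ τ c) fun p => abs_arcIndicator_le y₁ y₂ τ c p.1 p.2)).symm

/-- The probability that a uniform point falls into the proximity region of `u`. -/
noncomputable def outProb (y₁ y₂ τ c u : ℝ) : ℝ :=
  ∫ v, arcIndicator y₁ y₂ τ c u v ∂uniformLaw y₁ y₂

/-- The probability that `u` falls into the proximity region of a uniform point. -/
noncomputable def inProb (y₁ y₂ τ c u : ℝ) : ℝ :=
  ∫ v, arcIndicator y₁ y₂ τ c v u ∂uniformLaw y₁ y₂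

theorem integral_kernelH (hy : y₁ < y₂) (u : ℝ) :
    ∫ v, kernelH y₁ y₂ τ c u v ∂uniformLaw y₁ y₂ =
      (outProb y₁ y₂ τ c u + inProb y₁ y₂ τ c u) / 2 := by
  have := isProbabilityMeasure_uniformLaw hy
  simp only [kernelH_eq, outProb, inProb]
  rw [integral_div, integral_add]
  · exact integrable_of_measurable_of_bound
      (measurable_arcIndicator y₁ y₂ τ c).of_uncurry_left fun v => abs_arcIndicator_le _ _ _ _ _ v
  · exact integrable_of_measurable_of_bound
      (measurable_arcIndicator y₁ y₂ τ c).of_uncurry_right fun v => abs_arcIndicator_le _ _ _ _ v _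

theorem measurable_outProb (hy : y₁ < y₂) : Measurable (outProb y₁ y₂ τ c) :=
  have := isProbabilityMeasure_uniformLaw hy
  (measurable_arcIndicator y₁ y₂ τ c).stronglyMeasurable.integral_prod_right.measurable

theorem measurable_inProb (hy : y₁ < y₂) : Measurable (inProb y₁ y₂ τ c) :=
  have := isProbabilityMeasure_uniformLaw hy
  (measurable_arcIndicator y₁ y₂ τ c).stronglyMeasurable.integral_prod_left.measurable

theorem abs_outProb_le (hy : y₁ < y₂) (u : ℝ) : |outProb y₁ y₂ τ c u| ≤ 1 :=
  have := isProbabilityMeasure_uniformLaw hy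
  abs_integral_le_of_bound fun _ => abs_arcIndicator_le _ _ _ _ _ _

theorem abs_inProb_le (hy : y₁ < y₂) (u : ℝ) : |inProb y₁ y₂ τ c u| ≤ 1 :=
  have := isProbabilityMeasure_uniformLaw hy
  abs_integral_le_of_bound fun _ => abs_arcIndicator_le _ _ _ _ _ _

theorem integral_integral_kernelH (hy : y₁ < y₂) :
    ∫ u, ∫ v, kernelH y₁ y₂ τ c u v ∂uniformLaw y₁ y₂ ∂uniformLaw y₁ y₂ = mu y₁ y₂ τ c := by
  have := isProbabilityMeasure_uniformLaw hy
  simp only [integral_kernelH τ c hy]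
  rw [integral_div, integral_add]
  · unfold outProb inProb
    rw [integral_integral_arcIndicator τ c hy, integral_integral_arcIndicator_swap τ c hy]
    ring
  · exact integrable_of_measurable_of_bound (measurable_outProb τ c hy) (abs_outProb_le τ c hy)
  · exact integrable_of_measurable_of_bound (measurable_inProb τ c hy) (abs_inProb_le τ c hy)

theorem nu_eq_variance (hy : y₁ < y₂) :
    nu y₁ y₂ τ c = Var[fun u => ∫ v, kernelH y₁ y₂ τ c u v ∂uniformLaw y₁ y₂;
      uniformLaw y₁ y₂] :=
  have := isProbabilityMeasure_uniformLaw hy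
  covariance_kernel_eq_variance (measurable_kernelH y₁ y₂ τ c) (abs_kernelH_le y₁ y₂ τ c)

/-- The projection of the kernel is half of `outProb + inProb`, and its mean is `mu`; the 4 cancels
the squared half. -/
theorem four_mul_nu (hy : y₁ < y₂) :
    4 * nu y₁ y₂ τ c =
      ∫ u, (outProb y₁ y₂ τ c u + inProb y₁ y₂ τ c u) ^ 2 ∂uniformLaw y₁ y₂
        - 4 * mu y₁ y₂ τ c ^ 2 := by
  have := isProbabilityMeasure_uniformLaw hy
  rw [nu_eq_variance τ c hy, variance_eq_sub, integral_integral_kernelH τ c hy]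
  · simp only [Pi.pow_apply, integral_kernelH τ c hy, div_pow]
    rw [integral_div]
    ring
  · exact MemLp.of_bound (measurable_kernelH y₁ y₂ τ
      c).stronglyMeasurable.integral_prod_right.aestronglyMeasurable 1
      (ae_of_all _ fun u => abs_integral_le_of_bound (abs_kernelH_le y₁ y₂ τ c u))

/-- The **central limit theorem for the relative density** of the digraph. -/
theorem tendstoInDistribution_rho {Ω : Type*} [MeasurableSpace Ω] {P : Measure Ω}
    [IsProbabilityMeasure P] (hy : y₁ < y₂) {X : ℕ → Ω → ℝ}
    (hlaw : ∀ i, HasLaw (X i) (uniformLaw y₁ y₂) P) (hindep : iIndepFun X P) :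
    TendstoInDistribution
      (fun (n : ℕ) (ω : Ω) => √(n : ℝ) * (rho y₁ y₂ τ c n (fun i => X i ω) - mu y₁ y₂ τ c))
      atTop (id : ℝ → ℝ) (fun _ => P) (gaussianReal 0 (4 * nu y₁ y₂ τ c).toNNReal) := by
  have := isProbabilityMeasure_uniformLaw hy
  have h := tendstoInDistribution_uStatistic hlaw hindep (measurable_kernelH y₁ y₂ τ c)
    (kernelH_comm y₁ y₂ τ c) (abs_kernelH_le y₁ y₂ τ c)
  rw [integral_integral_kernelH τ c hy] at h
  rw [nu_eq_variance τ c hy]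
  refine h.congr (fun n => ae_of_all _ fun ω => ?_) EventuallyEq.rfl
  simp only
  rw [rho_eq_uStatistic y₁ y₂ τ c n fun i => X i ω]

/-! ### Integrals over the unit interval. -/

theorem integral_uniformLaw {y₁ y₂ : ℝ} (hy : y₁ < y₂) (f : ℝ → ℝ) :
    ∫ u, f u ∂uniformLaw y₁ y₂ = ∫ t in (0 : ℝ)..1, f (y₁ + (y₂ - y₁) * t) := by
  have hL : 0 < y₂ - y₁ := sub_pos.2 hy
  rw [intervalIntegral.integral_comp_add_mul f hL.ne', mul_zero, add_zero, mul_one,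
    add_sub_cancel, intervalIntegral.integral_of_le hy.le, integral_Ioc_eq_integral_Ioo,
    uniformLaw, ProbabilityTheory.cond, integral_smul_measure, Real.volume_Ioo,
    ENNReal.toReal_inv, ENNReal.toReal_ofReal hL.le]

theorem integral_unit_eq_sub {f : ℝ → ℝ} {α β : ℝ} (hα : 0 ≤ α) (hαβ : α ≤ β) (hβ : β ≤ 1)
    (h : ∀ s ∈ Set.Ioo (0 : ℝ) 1, f s = (Set.Ioo α β).indicator 1 s) :
    ∫ s in (0 : ℝ)..1, f s = β - α := by
  rw [intervalIntegral.integral_congr_Ioo_of_le zero_le_one h,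
    intervalIntegral.integral_of_le zero_le_one, integral_Ioc_eq_integral_Ioo,
    integral_indicator_one measurableSet_Ioo, measureReal_restrict_apply measurableSet_Ioo,
    Set.inter_eq_left.2 (Set.Ioo_subset_Ioo hα hβ), Real.volume_real_Ioo_of_le hαβ]

/-- The integrand is symmetric about 1/2. -/
theorem integral_comp_min_one_sub {φ : ℝ → ℝ} (hφ : Continuous φ) :
    ∫ t in (0 : ℝ)..1, φ (min t (1 - t)) = 2 * ∫ t in (0 : ℝ)..(1 / 2), φ t := by
  have hc : Continuous fun t : ℝ => φ (min t (1 - t)) := by fun_prop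
  rw [← intervalIntegral.integral_add_adjacent_intervals (b := 1 / 2)
    (hc.intervalIntegrable _ _) (hc.intervalIntegrable _ _)]
  have e1 : ∫ t in (0 : ℝ)..(1 / 2), φ (min t (1 - t)) = ∫ t in (0 : ℝ)..(1 / 2), φ t :=
    intervalIntegral.integral_congr_Ioo_of_le (by norm_num) fun t ht => by
      rw [min_eq_left (by linarith [ht.2])]
  have e2 : ∫ t in (1 / 2 : ℝ)..1, φ (min t (1 - t)) = ∫ t in (0 : ℝ)..(1 / 2), φ t := by
    rw [intervalIntegral.integral_congr_Ioo_of_le (g := fun t => φ (1 - t)) (by norm_num)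
      fun t ht => by rw [min_eq_right (by linarith [ht.1])],
      intervalIntegral.integral_comp_sub_left φ 1]
    norm_num
  rw [e1, e2, two_mul]

theorem integral_affine (α β p q : ℝ) :
    ∫ x in p..q, (α * x + β) = α * (q ^ 2 - p ^ 2) / 2 + β * (q - p) := by
  rw [intervalIntegral.integral_eq_sub_of_hasDerivAt (f := fun x => α * x ^ 2 / 2 + β * x)
    (fun x _ => ?_) ((by fun_prop : Continuous fun x : ℝ => α * x + β).intervalIntegrable _ _)]
  · ring
  · have h := (((hasDerivAt_pow 2 x).const_mul α).div_const 2).add ((hasDerivAt_id x).const_mul β)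
    exact h.congr_deriv (by push_cast; ring)

theorem integral_affine_sq (α β p q : ℝ) :
    ∫ x in p..q, (α * x + β) ^ 2 =
      α ^ 2 * (q ^ 3 - p ^ 3) / 3 + α * β * (q ^ 2 - p ^ 2) + β ^ 2 * (q - p) := by
  rw [intervalIntegral.integral_eq_sub_of_hasDerivAt
    (f := fun x => α ^ 2 * x ^ 3 / 3 + α * β * x ^ 2 + β ^ 2 * x)
    (fun x _ => ?_) ((by fun_prop : Continuous fun x : ℝ => (α * x + β) ^ 2).intervalIntegrable _ _)]
  · ring
  · have h := ((((hasDerivAt_pow 3 x).const_mul (α ^ 2)).div_const 3).add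
      ((hasDerivAt_pow 2 x).const_mul (α * β))).add ((hasDerivAt_id x).const_mul (β ^ 2))
    exact h.congr_deriv (by push_cast; ring)

/-! ### The case `c = 1/2` on the unit interval. -/

/-- The arc indicator of the central similarity digraph on the unit interval with centrality
parameter `1 / 2`. -/
noncomputable def unitArc (τ t s : ℝ) : ℝ := if |s - t| < τ * min t (1 - t) then 1 else 0

/-- The length of the proximity region of `t` in the unit interval. -/
noncomputable def unitOut (τ t : ℝ) : ℝ := ∫ s in (0 : ℝ)..1, unitArc τ t s

/-- The measure of the points of the unit interval whose proximity region contains `t`. -/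
noncomputable def unitIn (τ t : ℝ) : ℝ := ∫ s in (0 : ℝ)..1, unitArc τ s t

/-- For `c = 1/2` the ratio (1 - c)/c is 1, so both arms of the region have length τ times the
distance to the nearer end point. The truncation is automatic for s in (0, 1). -/
theorem arcIndicator_affine {y₁ y₂ : ℝ} (hy : y₁ < y₂) (τ : ℝ) {t s : ℝ}
    (ht : t ∈ Set.Ioo (0 : ℝ) 1) (hs : s ∈ Set.Ioo (0 : ℝ) 1) :
    arcIndicator y₁ y₂ τ (1 / 2) (y₁ + (y₂ - y₁) * t) (y₁ + (y₂ - y₁) * s) = unitArc τ t s := by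
  classical
  have hL : 0 < y₂ - y₁ := sub_pos.2 hy
  have hmem : ∀ {r : ℝ}, r ∈ Set.Ioo (0 : ℝ) 1 → y₁ + (y₂ - y₁) * r ∈ Set.Ioo y₁ y₂ :=
    fun {r} hr => ⟨by nlinarith [mul_pos hL hr.1], by nlinarith [mul_pos hL (sub_pos.2 hr.2)]⟩
  have hs' := hmem hs
  rw [arcIndicator, Set.indicator_apply, Pi.one_apply, unitArc]
  refine if_congr ?_ rfl rfl
  rw [proximityRegion, if_pos (hmem ht), abs_lt, ← mul_lt_mul_iff_right₀ hL,
    ← mul_lt_mul_iff_right₀ hL (b := s - t)]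
  by_cases h : t ≤ 1 / 2
  · rw [if_pos (by nlinarith), min_eq_left (by linarith)]
    simp only [Set.mem_inter_iff, hs', and_true, Set.mem_Ioo]
    constructor <;> rintro ⟨h1, h2⟩ <;> constructor <;> ring_nf at h1 h2 ⊢ <;> linarith
  · push Not at h
    rw [if_neg (by nlinarith), min_eq_right (by linarith)]
    simp only [Set.mem_inter_iff, hs', and_true, Set.mem_Ioo]
    constructor <;> rintro ⟨h1, h2⟩ <;> constructor <;> ring_nf at h1 h2 ⊢ <;> linarith

theorem outProb_affine {y₁ y₂ : ℝ} (hy : y₁ < y₂) (τ : ℝ) {t : ℝ} (ht : t ∈ Set.Ioo (0 : ℝ) 1) :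
    outProb y₁ y₂ τ (1 / 2) (y₁ + (y₂ - y₁) * t) = unitOut τ t := by
  rw [outProb, integral_uniformLaw hy, unitOut]
  exact intervalIntegral.integral_congr_Ioo_of_le zero_le_one fun s hs =>
    arcIndicator_affine hy τ ht hs

theorem inProb_affine {y₁ y₂ : ℝ} (hy : y₁ < y₂) (τ : ℝ) {t : ℝ} (ht : t ∈ Set.Ioo (0 : ℝ) 1) :
    inProb y₁ y₂ τ (1 / 2) (y₁ + (y₂ - y₁) * t) = unitIn τ t := by
  rw [inProb, integral_uniformLaw hy, unitIn]
  exact intervalIntegral.integral_congr_Ioo_of_le zero_le_one fun s hs =>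
    arcIndicator_affine hy τ hs ht

theorem unitArc_one_sub (τ t s : ℝ) : unitArc τ (1 - t) (1 - s) = unitArc τ t s := by
  rw [unitArc, unitArc, sub_sub_sub_cancel_left, abs_sub_comm, sub_sub_cancel, min_comm]

theorem unitOut_one_sub (τ t : ℝ) : unitOut τ (1 - t) = unitOut τ t := by
  have h := intervalIntegral.integral_comp_sub_left (a := 0) (b := 1)
    (fun s => unitArc τ (1 - t) s) 1
  simp only [unitArc_one_sub, sub_self, sub_zero] at h
  exact h.symm

theorem unitIn_one_sub (τ t : ℝ) : unitIn τ (1 - t) = unitIn τ t := by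
  have h := intervalIntegral.integral_comp_sub_left (a := 0) (b := 1)
    (fun s => unitArc τ s (1 - t)) 1
  simp only [unitArc_one_sub, sub_self, sub_zero] at h
  exact h.symm

theorem unitOut_min (τ t : ℝ) : unitOut τ (min t (1 - t)) = unitOut τ t := by
  rcases min_choice t (1 - t) with h | h <;> rw [h]
  exact unitOut_one_sub τ t

theorem unitIn_min (τ t : ℝ) : unitIn τ (min t (1 - t)) = unitIn τ t := by
  rcases min_choice t (1 - t) with h | h <;> rw [h]
  exact unitIn_one_sub τ t

/-- Resolves the absolute value and the minimum into four linear inequalities. The free point `r`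
lets either argument of the arc be the integration variable. -/
theorem unitArc_eq_indicator {τ t s : ℝ} {S : Set ℝ} {r : ℝ}
    (h : (t - s < τ * t ∧ s - t < τ * t) ∧ (t - s < τ * (1 - t) ∧ s - t < τ * (1 - t)) ↔ r ∈ S)
    (hτ : 0 < τ) : unitArc τ t s = S.indicator 1 r := by
  classical
  rw [unitArc, Set.indicator_apply, Pi.one_apply]
  refine if_congr ?_ rfl rfl
  rw [← h, mul_min_of_nonneg _ _ hτ.le, lt_min_iff, abs_sub_comm, abs_lt, abs_lt]
  constructor <;> rintro ⟨⟨h1, h2⟩, h3, h4⟩ <;> exact ⟨⟨by linarith, by linarith⟩, by linarith,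
    by linarith⟩

section

variable {τ t : ℝ}

/-- For τ < 1 and t ≤ 1/2 the region (t - τt, t + τt) lies inside the unit interval, so nothing is
cut off. -/
theorem unitOut_of_lt_one (hτ : 0 < τ) (hτ1 : τ < 1) (ht : 0 < t) (ht' : t ≤ 1 / 2) :
    unitOut τ t = 2 * τ * t := by
  have h0 : 0 < τ * t := mul_pos hτ ht
  have h1 : τ * t ≤ t := by nlinarith
  have h2 : τ * t ≤ τ * (1 - t) := by nlinarith
  rw [unitOut, integral_unit_eq_sub (α := t - τ * t) (β := t + τ * t) (by linarith) (by linarith)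
    (by linarith) fun s hs => unitArc_eq_indicator ?_ hτ]
  · ring
  · rw [Set.mem_Ioo]
    constructor
    · rintro ⟨⟨h3, h4⟩, -⟩
      constructor <;> linarith
    · rintro ⟨h3, h4⟩
      refine ⟨⟨?_, ?_⟩, ?_, ?_⟩ <;> linarith

/-- For τ ≥ 1 the left arm always reaches 0; the right arm may be cut off at 1. -/
theorem unitOut_of_one_le (hτ1 : 1 ≤ τ) (ht : 0 < t) (ht' : t ≤ 1 / 2) :
    unitOut τ t = min ((1 + τ) * t) 1 := by
  have hτ : 0 < τ := by linarith
  have h1 : t ≤ τ * t := by nlinarith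
  have h2 : τ * t ≤ τ * (1 - t) := by nlinarith
  rw [unitOut, integral_unit_eq_sub (α := 0) (β := min ((1 + τ) * t) 1) le_rfl
    (le_min (by positivity) zero_le_one) (min_le_right _ _)
    fun s hs => unitArc_eq_indicator ?_ hτ]
  · ring
  · rw [Set.mem_Ioo, lt_min_iff]
    constructor
    · rintro ⟨⟨h3, h4⟩, -⟩
      exact ⟨hs.1, by linarith, hs.2⟩
    · rintro ⟨-, h4, -⟩
      have := hs.1
      refine ⟨⟨?_, ?_⟩, ?_, ?_⟩ <;> linarith

/-- Solving the four inequalities for s gives t/(1 + τ) < s < min(t/(1 - τ), (t + τ)/(1 + τ)); the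
other lower bound (t - τ)/(1 - τ) is smaller when t ≤ 1/2. -/
theorem unitIn_of_lt_one (hτ : 0 < τ) (hτ1 : τ < 1) (ht : 0 < t) (ht' : t ≤ 1 / 2) :
    unitIn τ t = min (2 * τ / (1 - τ ^ 2) * t) (τ / (1 + τ)) := by
  have hp : 0 < 1 + τ := by linarith
  have hm : 0 < 1 - τ := by linarith
  have hpm : 0 < 1 - τ ^ 2 := by nlinarith
  have hsub : min (t / (1 - τ)) ((t + τ) / (1 + τ)) - t / (1 + τ) =
      min (2 * τ / (1 - τ ^ 2) * t) (τ / (1 + τ)) := by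
    rw [← min_sub_sub_right]
    congr 1
    · have : 1 - τ ^ 2 = (1 - τ) * (1 + τ) := by ring
      rw [this]
      field_simp
      ring
    · field_simp
      ring
  rw [unitIn, ← hsub]
  refine integral_unit_eq_sub (by positivity) ?_ ?_ fun s hs => unitArc_eq_indicator ?_ hτ
  · rw [← sub_nonneg, hsub]
    exact le_min (by positivity) (by positivity)
  · refine (min_le_right _ _).trans ?_
    rw [div_le_one hp]
    linarith
  · rw [Set.mem_Ioo, lt_min_iff, div_lt_iff₀ hp, lt_div_iff₀ hm, lt_div_iff₀ hp]
    constructor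
    · rintro ⟨⟨h1, h2⟩, h3, h4⟩
      refine ⟨?_, ?_, ?_⟩ <;> linarith
    · rintro ⟨h1, h2, h3⟩
      refine ⟨⟨?_, ?_⟩, ?_, ?_⟩ <;> try linarith
      -- The non-binding inequality t - s < τ(1 - s), which follows from t < s(1 + τ) because 2t ≤ 1
      -- + τ.
      nlinarith

theorem unitIn_of_one_le (hτ1 : 1 ≤ τ) (ht : 0 < t) (ht' : t ≤ 1 / 2) :
    unitIn τ t = τ / (1 + τ) := by
  have hp : 0 < 1 + τ := by linarith
  have hτ : 0 < τ := by linarith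
  have hsub : (t + τ) / (1 + τ) - t / (1 + τ) = τ / (1 + τ) := by ring
  rw [unitIn, ← hsub]
  refine integral_unit_eq_sub (by positivity) ?_ ?_ fun s hs => unitArc_eq_indicator ?_ hτ
  · gcongr
    linarith
  · rw [div_le_one hp]
    linarith
  · rw [Set.mem_Ioo, div_lt_iff₀ hp, lt_div_iff₀ hp]
    -- These two bounds make s - t < τs and t - s < τ(1 - s) automatic for τ ≥ 1, so only two
    -- inequalities bind.
    have h5 : (τ - 1) * s ≤ τ - 1 := by nlinarith [hs.2]
    have h6 : 0 ≤ (τ - 1) * s := mul_nonneg (by linarith) hs.1.le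
    constructor
    · rintro ⟨⟨h1, h2⟩, h3, h4⟩
      constructor <;> linarith
    · rintro ⟨h1, h2⟩
      refine ⟨⟨?_, ?_⟩, ?_, ?_⟩ <;> linarith

end

theorem min_one_sub_mem {t : ℝ} (ht : t ∈ Set.Ioo (0 : ℝ) 1) :
    0 < min t (1 - t) ∧ min t (1 - t) ≤ 1 / 2 := by
  refine ⟨lt_min ht.1 (sub_pos.2 ht.2), ?_⟩
  rcases le_total t (1 / 2) with h | h
  · exact (min_le_left _ _).trans h
  · exact (min_le_right _ _).trans (by linarith)

/-! ### Closed forms of the mean and the asymptotic variance. -/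

section Moments

variable {y₁ y₂ τ : ℝ}

theorem mu_eq_of_unitOut_eq (hy : y₁ < y₂) {a : ℝ → ℝ} (ha : Continuous a)
    (hout : ∀ t, 0 < t → t ≤ 1 / 2 → unitOut τ t = a t) :
    mu y₁ y₂ τ (1 / 2) = 2 * ∫ t in (0 : ℝ)..(1 / 2), a t := by
  rw [← integral_integral_arcIndicator τ (1 / 2) hy, ← integral_comp_min_one_sub ha]
  change ∫ u, outProb y₁ y₂ τ (1 / 2) u ∂uniformLaw y₁ y₂ = _
  rw [integral_uniformLaw hy]
  refine intervalIntegral.integral_congr_Ioo_of_le zero_le_one fun t ht => ?_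
  have hd := min_one_sub_mem ht
  rw [outProb_affine hy τ ht, ← unitOut_min, hout _ hd.1 hd.2]

theorem four_mul_nu_eq_of_unitOut_eq (hy : y₁ < y₂) {a b : ℝ → ℝ} (ha : Continuous a)
    (hb : Continuous b) (hout : ∀ t, 0 < t → t ≤ 1 / 2 → unitOut τ t = a t)
    (hin : ∀ t, 0 < t → t ≤ 1 / 2 → unitIn τ t = b t) :
    4 * nu y₁ y₂ τ (1 / 2) =
      2 * (∫ t in (0 : ℝ)..(1 / 2), (a t + b t) ^ 2) - 4 * mu y₁ y₂ τ (1 / 2) ^ 2 := by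
  rw [four_mul_nu τ (1 / 2) hy, ← integral_comp_min_one_sub (φ := fun t => (a t + b t) ^ 2) (by fun_prop),
    integral_uniformLaw hy]
  congr 1
  refine intervalIntegral.integral_congr_Ioo_of_le zero_le_one fun t ht => ?_
  have hd := min_one_sub_mem ht
  rw [outProb_affine hy τ ht, inProb_affine hy τ ht, ← unitOut_min, ← unitIn_min,
    hout _ hd.1 hd.2, hin _ hd.1 hd.2]

theorem mu_of_lt_one (hy : y₁ < y₂) (hτ : 0 < τ) (hτ1 : τ < 1) :
    mu y₁ y₂ τ (1 / 2) = τ / 2 := by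
  rw [mu_eq_of_unitOut_eq hy (a := fun t => 2 * τ * t) (by fun_prop)
    fun t => unitOut_of_lt_one hτ hτ1]
  have h := integral_affine (2 * τ) 0 0 (1 / 2)
  simp only [add_zero] at h
  rw [h]
  ring

theorem integral_min_piecewise {a b c : ℝ → ℝ} {k : ℝ} (hk : 0 ≤ k) (hk' : k ≤ 1 / 2)
    (ha : Continuous a) (h1 : ∀ t, t < k → a t = b t) (h2 : ∀ t, k < t → a t = c t) :
    ∫ t in (0 : ℝ)..(1 / 2), a t = (∫ t in (0 : ℝ)..k, b t) + ∫ t in k..(1 / 2), c t := by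
  rw [← intervalIntegral.integral_add_adjacent_intervals (b := k)
    (ha.intervalIntegrable _ _) (ha.intervalIntegrable _ _),
    intervalIntegral.integral_congr_Ioo_of_le hk fun t ht => h1 t ht.2,
    intervalIntegral.integral_congr_Ioo_of_le hk' fun t ht => h2 t ht.1]

theorem mu_of_one_le (hy : y₁ < y₂) (hτ1 : 1 ≤ τ) :
    mu y₁ y₂ τ (1 / 2) = τ / (τ + 1) := by
  have hp : 0 < 1 + τ := by linarith
  have hp' : 0 < τ + 1 := by linarith
  rw [mu_eq_of_unitOut_eq hy (a := fun t => min ((1 + τ) * t) 1) (by fun_prop)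
    fun t => unitOut_of_one_le hτ1,
    -- The kink is where (1 + τ)t reaches 1, and it is at most 1/2 since τ ≥ 1. The zero terms give
    -- the pieces the shape of `integral_affine`.
    integral_min_piecewise (k := 1 / (1 + τ)) (b := fun t => (1 + τ) * t + 0)
      (c := fun t => 0 * t + 1) (by positivity) (by gcongr; linarith) (by fun_prop)
      (fun t ht => ?_) (fun t ht => ?_), integral_affine, integral_affine]
  · field_simp
    ring
  · rw [lt_div_iff₀ hp] at ht
    rw [min_eq_left (by linarith), add_zero]
  · rw [div_lt_iff₀ hp] at ht
    rw [min_eq_right (by linarith), zero_mul, zero_add]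

theorem four_mul_nu_of_lt_one (hy : y₁ < y₂) (hτ : 0 < τ) (hτ1 : τ < 1) :
    4 * nu y₁ y₂ τ (1 / 2) =
      τ ^ 2 * (1 + 2 * τ - τ ^ 2 - τ ^ 3) / (3 * (τ + 1) ^ 2) := by
  have hp : 0 < 1 + τ := by linarith
  have hp' : 0 < τ + 1 := by linarith
  have hm : 0 < 1 - τ := by linarith
  have hpm : 1 - τ ^ 2 = (1 - τ) * (1 + τ) := by ring
  -- The two branches of the in-probability cross at t = (1 - τ)/2.
  have hcmp : ∀ t, 2 * τ / (1 - τ ^ 2) * t ≤ τ / (1 + τ) ↔ t ≤ (1 - τ) / 2 := fun t => by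
    rw [hpm, show 2 * τ / ((1 - τ) * (1 + τ)) * t = τ / (1 + τ) * (2 * t / (1 - τ)) by
        field_simp, mul_le_iff_le_one_right (by positivity), div_le_one hm]
    constructor <;> intro h <;> linarith
  rw [four_mul_nu_eq_of_unitOut_eq hy (a := fun t => 2 * τ * t)
      (b := fun t => min (2 * τ / (1 - τ ^ 2) * t) (τ / (1 + τ))) (by fun_prop) (by fun_prop)
      (fun t => unitOut_of_lt_one hτ hτ1) (fun t => unitIn_of_lt_one hτ hτ1),
    mu_of_lt_one hy hτ hτ1,
    integral_min_piecewise (k := (1 - τ) / 2)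
      (b := fun t => ((2 * τ + 2 * τ / (1 - τ ^ 2)) * t + 0) ^ 2)
      (c := fun t => (2 * τ * t + τ / (1 + τ)) ^ 2) (by linarith) (by linarith) (by fun_prop)
      (fun t ht => ?_) (fun t ht => ?_), integral_affine_sq, integral_affine_sq, hpm]
  · field_simp
    ring
  · rw [min_eq_left ((hcmp t).2 ht.le)]
    ring
  · rw [min_eq_right (le_of_not_ge fun h => absurd ((hcmp t).1 h) (not_le.2 ht))]

theorem four_mul_nu_of_one_le (hy : y₁ < y₂) (hτ1 : 1 ≤ τ) :
    4 * nu y₁ y₂ τ (1 / 2) = (2 * τ - 1) / (3 * (τ + 1) ^ 2) := by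
  have hp : 0 < 1 + τ := by linarith
  have hp' : 0 < τ + 1 := by linarith
  rw [four_mul_nu_eq_of_unitOut_eq hy (a := fun t => min ((1 + τ) * t) 1)
      (b := fun _ => τ / (1 + τ)) (by fun_prop) (by fun_prop)
      (fun t => unitOut_of_one_le hτ1) (fun t => unitIn_of_one_le hτ1),
    mu_of_one_le hy hτ1,
    integral_min_piecewise (k := 1 / (1 + τ))
      (b := fun t => ((1 + τ) * t + τ / (1 + τ)) ^ 2)
      (c := fun t => (0 * t + (1 + τ / (1 + τ))) ^ 2) (by positivity) (by gcongr; linarith)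
      (by fun_prop) (fun t ht => ?_) (fun t ht => ?_), integral_affine_sq, integral_affine_sq]
  · field_simp
    ring
  · rw [lt_div_iff₀ hp] at ht
    rw [min_eq_left (by linarith)]
  · rw [div_lt_iff₀ hp] at ht
    rw [min_eq_right (by linarith), zero_mul, zero_add]

end Moments

end CentralSimilarity

theorem mainTheorem5
    {Ω : Type*} [MeasurableSpace Ω] (P : Measure Ω) [IsProbabilityMeasure P]
    (y₁ y₂ : ℝ) (hy : y₁ < y₂) (τ : ℝ) (hτ : 0 < τ)
    (X : ℕ → Ω → ℝ)
    (hX_law : ∀ i, HasLaw (X i) (CentralSimilarity.uniformLaw y₁ y₂) P)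
    (hX_indep : iIndepFun X P) :
    TendstoInDistribution
        (fun (n : ℕ) (ω : Ω) =>
          √(n : ℝ) * (CentralSimilarity.rho y₁ y₂ τ (1 / 2) n (fun i => X i ω)
            - CentralSimilarity.mu y₁ y₂ τ (1 / 2)))
        atTop (id : ℝ → ℝ) (fun _ => P)
        (gaussianReal 0 (4 * CentralSimilarity.nu y₁ y₂ τ (1 / 2)).toNNReal)
      ∧ CentralSimilarity.mu y₁ y₂ τ (1 / 2) = (if τ < 1 then τ / 2 else τ / (τ + 1))
      ∧ 4 * CentralSimilarity.nu y₁ y₂ τ (1 / 2) =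
          (if τ < 1 then τ ^ 2 * (1 + 2 * τ - τ ^ 2 - τ ^ 3) / (3 * (τ + 1) ^ 2)
            else (2 * τ - 1) / (3 * (τ + 1) ^ 2)) := by
  refine ⟨CentralSimilarity.tendstoInDistribution_rho τ (1 / 2) hy hX_law hX_indep, ?_, ?_⟩
  · split_ifs with h
    · exact CentralSimilarity.mu_of_lt_one hy hτ h
    · exact CentralSimilarity.mu_of_one_le hy (not_lt.1 h)
  · split_ifs with h
    · exact CentralSimilarity.four_mul_nu_of_lt_one hy hτ h
    · exact CentralSimilarity.four_mul_nu_of_one_le hy (not_lt.1 h)
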